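/- Let $r,c,\sigma,\lambda,\varepsilon>0$, $\mu>r$, $w_s:=c/r$ and $b<w_s$. Put \[R=\frac12\Big(\frac{\mu-r}{\sigma}\Big)^2,\qquad d=\frac1{2r}\Big[(r+\lambda+R)+\sqrt{(r+\lambda+R)^2-4r\lambda}\Big],\qquad \pi_0(w)=\frac{\mu-r}{\sigma^2}\,\frac{c-rw}{(d-1)r},\] where $\pi_0$ is the optimal strategy of the non-robust problem, and $d>1$. For real $w,y,p,q$ let \[F(w,y,p,q)=\lambda y-\inf_{\pi\in\mathbb R}\Big\{\tfrac12\sigma^2(\varepsilon p^2+q)\pi^2+(\mu-r)p\,\pi+(rw-c)p\Big\}\in(-\infty,+\infty].\] Let $\hat u:[b,w_s]\to\mathbb R$ be a continuous viscosity solution of the Dirichlet problem \[F(w,\hat u,\hat u',\hat u'')=0\ \text{ in }(b,w_s),\qquad \hat u(b)=1,\quad \hat u(w_s)=0,\] that is, $\hat u$ is continuous with these boundary values and, for every $\varphi\in C^2(b,w_s)$ and $w_0\in(b,w_s)$, one has $F(w_0,\hat u(w_0),\varphi'(w_0),\varphi''(w_0))\le0$ if $\hat u-\varphi$ has a local maximum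 at $w_0$, and $F(w_0,\hat u(w_0),\varphi'(w_0),\varphi''(w_0))\ge0$ if $\hat u-\varphi$ has a local minimum at $w_0$. Then $\hat u\in C^2(b,w_s)$ and $\varepsilon(\hat u')^2+\hat u''>0$ in $(b,w_s)$, so that the optimal feedback strategy \[\pi^*(w)=-\frac{\mu-r}{\sigma^2}\,\frac{\hat u'(w)}{\varepsilon(\hat u'(w))^2+\hat u''(w)},\qquad w\in(b,w_s),\] is well defined and attains the infimum in $F(w,\hat u(w),\hat u'(w),\hat u''(w))$. Moreover, $\pi^*$ is Lipschitz continuous on $(b,w_s)$, it is differentiable there, and \[\lim_{w\to w_s-}(\pi^*)'(w)=-\frac{\mu-r}{\sigma^2(d-1)}=\pi_0'(w_s).\] Also $\lim_{w\to w_s-}\pi^*(w)=0=\pi_0(w_s)$; thus $\pi^*$ is tangent to $\pi_0$ at $w_s$. -/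

import Mathlib

open Set Filter Topology

/-- The possible values of the bracket in the Hamilton--Jacobi--Bellman equation: for wealth `w`,
first derivative `p`, second derivative `q` and amount `a` invested in the risky asset,
`(1/2) σ² (ε p² + q) a² + (μ - r) p a + (r w - c) p`. -/
noncomputable def hjbBracket (r μ σ c ε w p q a : ℝ) : ℝ :=
  1 / 2 * σ ^ 2 * (ε * p ^ 2 + q) * a ^ 2 + (μ - r) * p * a + (r * w - c) * p

/-- The operator `F(w, y, p, q) = lam * y - inf_a hjbBracket`, with the infimum over all real `a`
(no constraint on the investment). The infimum may be `-∞`, and then `F = +∞`; hence the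
extended-real values. -/
noncomputable def hjbOperator (r μ σ c lam ε w y p q : ℝ) : EReal :=
  ((lam * y : ℝ) : EReal) - ⨅ a : ℝ, ((hjbBracket r μ σ c ε w p q a : ℝ) : EReal)

/-- `u` satisfies the viscosity subsolution inequality of `F(w, u, u', u'') = 0` in `(b, e)`:
whenever `u - φ` has a local maximum at an interior point, for a `C²` test function `φ`,
`F ≤ 0` holds there. -/
def IsViscositySubsolution (F : ℝ → ℝ → ℝ → ℝ → EReal) (b e : ℝ) (u : ℝ → ℝ) : Prop :=
  ∀ φ : ℝ → ℝ, ContDiffOn ℝ 2 φ (Ioo b e) → ∀ x ∈ Ioo b e,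
    IsLocalMax (fun w => u w - φ w) x → F x (u x) (deriv φ x) (deriv (deriv φ) x) ≤ 0

/-- `u` satisfies the viscosity supersolution inequality of `F(w, u, u', u'') = 0` in `(b, e)`:
whenever `u - φ` has a local minimum at an interior point, for a `C²` test function `φ`,
`F ≥ 0` holds there. -/
def IsViscositySupersolution (F : ℝ → ℝ → ℝ → ℝ → EReal) (b e : ℝ) (u : ℝ → ℝ) : Prop :=
  ∀ φ : ℝ → ℝ, ContDiffOn ℝ 2 φ (Ioo b e) → ∀ x ∈ Ioo b e,
    IsLocalMin (fun w => u w - φ w) x → 0 ≤ F x (u x) (deriv φ x) (deriv (deriv φ) x)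

/-- `u` is a continuous viscosity solution, on the interval from the ruin level `b` to the safe
level `c / r`, of the Dirichlet problem `F(w, u, u', u'') = 0` in `(b, c / r)`, `u b = 1`,
`u (c / r) = 0`. -/
structure IsRobustRuinSolution (r μ σ c lam ε b : ℝ) (u : ℝ → ℝ) : Prop where
  continuousOn : ContinuousOn u (Icc b (c / r))
  subsolution : IsViscositySubsolution (hjbOperator r μ σ c lam ε) b (c / r) u
  supersolution : IsViscositySupersolution (hjbOperator r μ σ c lam ε) b (c / r) u
  ruin : u b = 1
  safe : u (c / r) = 0

/-- The feedback strategy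
`π*(w) = -((μ - r) / σ²) * u'(w) / (ε u'(w)² + u''(w))` belonging to `u`. -/
noncomputable def robustStrategy (r μ σ ε : ℝ) (u : ℝ → ℝ) (w : ℝ) : ℝ :=
  -((μ - r) / σ ^ 2) * (deriv u w / (ε * deriv u w ^ 2 + deriv (deriv u) w))

/-- The constant `R = (1/2) ((μ - r) / σ)²`. -/
noncomputable def constR (r μ σ : ℝ) : ℝ := 1 / 2 * ((μ - r) / σ) ^ 2

/-- The constant `d = (1 / (2 r)) [(r + lam + R) + √((r + lam + R)² - 4 r lam)]`. -/
noncomputable def constD (r μ σ lam : ℝ) : ℝ :=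
  1 / (2 * r) * ((r + lam + constR r μ σ) +
    Real.sqrt ((r + lam + constR r μ σ) ^ 2 - 4 * r * lam))

/-- The optimal strategy of the non-robust problem,
`π₀(w) = ((μ - r) / σ²) * (c - r w) / ((d - 1) r)`. -/
noncomputable def nonRobustStrategy (r μ σ c lam w : ℝ) : ℝ :=
  (μ - r) / σ ^ 2 * ((c - r * w) / ((constD r μ σ lam - 1) * r))

/-! ### Touching parabolas, convexity and second derivatives -/

/-- The parabola through `(x, f x)` with slope `p` and second derivative `q` lies above `f`
near `x`. -/
def UpperParabola (f : ℝ → ℝ) (x p q : ℝ) : Prop :=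
  ∀ᶠ w in 𝓝 x, f w ≤ f x + p * (w - x) + q / 2 * (w - x) ^ 2

/-- The parabola through `(x, f x)` with slope `p` and second derivative `q` lies below `f`
near `x`. -/
def LowerParabola (f : ℝ → ℝ) (x p q : ℝ) : Prop :=
  ∀ᶠ w in 𝓝 x, f x + p * (w - x) + q / 2 * (w - x) ^ 2 ≤ f w

/-- A continuous function that is touched from above only by convex parabolas is convex. -/
theorem convexOn_of_upperParabola {f : ℝ → ℝ} {a e : ℝ} (hf : ContinuousOn f (Ioo a e))
    (h : ∀ y ∈ Ioo a e, ∀ p q, UpperParabola f y p q → 0 ≤ q) :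
    ConvexOn ℝ (Ioo a e) f := by
  refine LinearOrder.convexOn_of_lt (convex_Ioo a e) ?_
  intro x hx z hz hxz s t hs ht hst
  by_contra! hlt
  simp only [smul_eq_mul] at hlt
  set m := s * x + t * z with hm
  have hmx : m - x = t * (z - x) := by rw [hm]; linear_combination x * hst
  have hxm : x < m := by nlinarith
  have hmz : m < z := by nlinarith
  obtain ⟨κ, hκ⟩ : ∃ κ, κ = (f z - f x) / (z - x) := ⟨_, rfl⟩
  have hκz : κ * (z - x) = f z - f x := by
    rw [hκ]; exact div_mul_cancel₀ _ (by linarith)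
  have hM : 0 < f m - (f x + κ * (m - x)) := by
    rw [hmx, show κ * (t * (z - x)) = t * (κ * (z - x)) by ring, hκz]
    have : s = 1 - t := by linarith
    subst this; linarith
  -- The concave perturbation is worth at most half the excess of `f` over its chord at `m`, so the
  -- maximum stays off both endpoints and yields a touching parabola with `q = -2 η < 0`.
  obtain ⟨η, hη⟩ : ∃ η, η = (f m - (f x + κ * (m - x))) / (2 * (z - x) ^ 2) := ⟨_, rfl⟩
  have hη0 : 0 < η := by rw [hη]; have := sub_pos.2 hxz; positivity
  have hηz : 2 * (η * (z - x) ^ 2) = f m - (f x + κ * (m - x)) := by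
    rw [hη]; have := sub_pos.2 hxz; field_simp
  have hsub : Icc x z ⊆ Ioo a e := fun w hw => ⟨hx.1.trans_le hw.1, hw.2.trans_lt hz.2⟩
  obtain ⟨y, hy, hmax⟩ := isCompact_Icc.exists_isMaxOn (nonempty_Icc.2 hxz.le)
    (f := fun w => f w - (f x + κ * (w - x)) + η * (w - x) ^ 2)
    (((hf.mono hsub).sub (by fun_prop)).add (by fun_prop))
  have hmax' := isMaxOn_iff.1 hmax
  have hym := hmax' m ⟨hxm.le, hmz.le⟩
  have hpos : 0 ≤ η * (m - x) ^ 2 := by positivity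
  have hyx : y ≠ x := by
    rintro rfl
    simp only [sub_self] at hym
    nlinarith
  have hyz : y ≠ z := by
    rintro rfl
    simp only [hκz] at hym
    nlinarith
  have hyI : y ∈ Ioo x z := ⟨lt_of_le_of_ne hy.1 hyx.symm, lt_of_le_of_ne hy.2 hyz⟩
  have := h y (hsub hy) (κ - 2 * η * (y - x)) (-2 * η) (by
    filter_upwards [Icc_mem_nhds hyI.1 hyI.2] with w hw
    have := hmax' w hw
    nlinarith)
  linarith

/-- Every open interval contains a point at which a given continuous function is touched from
above by a parabola. -/
theorem exists_upperParabola {f : ℝ → ℝ} {x z : ℝ} (hxz : x < z)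
    (hf : ContinuousOn f (Icc x z)) : ∃ y ∈ Ioo x z, ∃ p q, UpperParabola f y p q := by
  set m := (x + z) / 2 with hm
  -- `K` is so large that the penalty at the endpoints outweighs the values of `f` there, which
  -- makes the maximum interior.
  obtain ⟨K, hK⟩ : ∃ K, K = (|f x| + |f z| + |f m| + 1) / ((z - x) / 2) ^ 2 := ⟨_, rfl⟩
  have hKz : K * ((z - x) / 2) ^ 2 = |f x| + |f z| + |f m| + 1 := by
    rw [hK]; have := sub_pos.2 hxz; field_simp
  obtain ⟨y, hy, hmax⟩ := isCompact_Icc.exists_isMaxOn (nonempty_Icc.2 hxz.le)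
    (f := fun w => f w - K * (w - m) ^ 2) (hf.sub (by fun_prop))
  have hmax' := isMaxOn_iff.1 hmax
  have hym := hmax' m ⟨by linarith, by linarith⟩
  have h1 := neg_abs_le (f m)
  have h2 := le_abs_self (f x)
  have h3 := le_abs_self (f z)
  have hyx : y ≠ x := by
    rintro rfl
    have : K * (y - m) ^ 2 = |f y| + |f z| + |f m| + 1 := by rw [← hKz, hm]; ring
    simp only [this, sub_self] at hym
    have := abs_nonneg (f z); norm_num at hym; linarith
  have hyz : y ≠ z := by
    rintro rfl
    have : K * (y - m) ^ 2 = |f x| + |f y| + |f m| + 1 := by rw [← hKz, hm]; ring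
    simp only [this, sub_self] at hym
    have := abs_nonneg (f x); norm_num at hym; linarith
  have hyI : y ∈ Ioo x z := ⟨lt_of_le_of_ne hy.1 hyx.symm, lt_of_le_of_ne hy.2 hyz⟩
  refine ⟨y, hyI, 2 * K * (y - m), 2 * K, ?_⟩
  filter_upwards [Icc_mem_nhds hyI.1 hyI.2] with w hw
  have := hmax' w hw
  nlinarith

/-- A differentiable convex function on an open interval is continuously differentiable. -/
theorem ConvexOn.continuousOn_of_hasDerivAt {f f' : ℝ → ℝ} {a e : ℝ}
    (hf : ConvexOn ℝ (Ioo a e) f) (hd : ∀ x ∈ Ioo a e, HasDerivAt f (f' x) x) :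
    ContinuousOn f' (Ioo a e) := by
  intro x hx
  apply ContinuousAt.continuousWithinAt
  have hslope := hasDerivAt_iff_tendsto_slope.1 (hd x hx)
  have hcont : ∀ z, z ≠ x → Tendsto (fun y => slope f y z) (𝓝 x) (𝓝 (slope f x z)) := by
    intro z hz
    simp only [slope_def_field]
    exact (tendsto_const_nhds.sub (hd x hx).continuousAt).div
      (tendsto_const_nhds.sub tendsto_id) (sub_ne_zero.2 hz)
  -- A secant from a fixed `z` left of `x` bounds `f' y` from below for `y` near `x`, one from the
  -- right bounds it from above, and these secants depend continuously on `y`.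
  refine tendsto_order.2 ⟨fun l hl => ?_, fun l hl => ?_⟩
  · have h1 : ∀ᶠ z in 𝓝[<] x, l < slope f x z :=
      (hslope.mono_left (nhdsWithin_mono _ fun z hz => ne_of_lt hz)).eventually (lt_mem_nhds hl)
    obtain ⟨z, ⟨hz1, hz2⟩, hz3⟩ := ((h1.and self_mem_nhdsWithin).and
      (nhdsWithin_le_nhds (Ioo_mem_nhds hx.1 hx.2))).exists
    have hz2 : z < x := hz2
    filter_upwards [(hcont z hz2.ne).eventually (lt_mem_nhds hz1), Ioo_mem_nhds hx.1 hx.2,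
      lt_mem_nhds hz2] with y hy hyI hzy
    rw [slope_comm] at hy
    exact hy.trans_le (hf.slope_le_of_hasDerivAt hz3 hyI hzy (hd y hyI))
  · have h1 : ∀ᶠ z in 𝓝[>] x, slope f x z < l :=
      (hslope.mono_left (nhdsWithin_mono _ fun z hz => ne_of_gt hz)).eventually (gt_mem_nhds hl)
    obtain ⟨z, ⟨hz1, hz2⟩, hz3⟩ := ((h1.and self_mem_nhdsWithin).and
      (nhdsWithin_le_nhds (Ioo_mem_nhds hx.1 hx.2))).exists
    have hz2 : x < z := hz2
    filter_upwards [(hcont z hz2.ne').eventually (gt_mem_nhds hz1), Ioo_mem_nhds hx.1 hx.2,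
      gt_mem_nhds hz2] with y hy hyI hzy
    exact (hf.le_slope_of_hasDerivAt hyI hz3 hzy (hd y hyI)).trans_lt hy

/-- A continuously differentiable viscosity solution of `f'' = h` is a classical one. -/
theorem hasDerivAt_of_parabolas {f f' h : ℝ → ℝ} {a e y : ℝ} (hy : y ∈ Ioo a e)
    (hd : ∀ x ∈ Ioo a e, HasDerivAt f (f' x) x) (hh : ContinuousAt h y)
    (hpos : 0 < h y)
    (hup : ∀ x ∈ Ioo a e, ∀ p q, UpperParabola f x p q → h x ≤ q)
    (hlo : ∀ x ∈ Ioo a e, ∀ p q, 0 < q → LowerParabola f x p q → q ≤ h x) :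
    HasDerivAt f' (h y) y := by
  rw [hasDerivAt_iff_isLittleO, Asymptotics.isLittleO_iff]
  intro δ' hδ'
  obtain ⟨δ, hδ0, hδδ', hδh⟩ : ∃ δ, 0 < δ ∧ δ ≤ δ' ∧ δ < h y :=
    ⟨min δ' (h y / 2), by positivity, min_le_left _ _,
      (min_le_right _ _).trans_lt (by linarith)⟩
  have hnear : ∀ᶠ x in 𝓝 y, x ∈ Ioo a e ∧ h y - δ < h x ∧ h x < h y + δ := by
    filter_upwards [Ioo_mem_nhds hy.1 hy.2, hh.eventually (lt_mem_nhds (sub_lt_self _ hδ0)),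
      hh.eventually (gt_mem_nhds (lt_add_of_pos_right _ hδ0))] with x h1 h2 h3 using ⟨h1, h2, h3⟩
  obtain ⟨l, u, hyI, hI⟩ := mem_nhds_iff_exists_Ioo_subset.1 hnear
  have hdq : ∀ A x, HasDerivAt (fun w : ℝ => A / 2 * w ^ 2) (A * x) x := fun A x =>
    ((hasDerivAt_pow 2 x).const_mul (A / 2)).congr_deriv (by norm_num; ring)
  have hd1 : ∀ x ∈ Ioo l u, HasDerivAt (fun w => f w - (h y - δ) / 2 * w ^ 2)
      (f' x - (h y - δ) * x) x := fun x hx => (hd x (hI hx).1).sub (hdq _ x)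
  have hd2 : ∀ x ∈ Ioo l u, HasDerivAt (fun w => (h y + δ) / 2 * w ^ 2 - f w)
      ((h y + δ) * x - f' x) x := fun x hx => (hdq _ x).sub (hd x (hI hx).1)
  -- Near `y`, `f` is squeezed between curvatures `h y - δ` and `h y + δ` in the sense of convexity.
  -- Monotone derivatives then put the difference quotients of `f'` at `y` within `δ` of `h y`.
  have c1 : ConvexOn ℝ (Ioo l u) (fun w => f w - (h y - δ) / 2 * w ^ 2) := by
    refine convexOn_of_upperParabola
      (fun x hx => (hd1 x hx).continuousAt.continuousWithinAt) fun x hx p q hpq => ?_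
    have := hup x (hI hx).1 (p + (h y - δ) * x) (q + (h y - δ)) (by
      filter_upwards [hpq] with w hw
      linear_combination hw)
    linarith [(hI hx).2.1]
  have c2 : ConvexOn ℝ (Ioo l u) (fun w => (h y + δ) / 2 * w ^ 2 - f w) := by
    refine convexOn_of_upperParabola
      (fun x hx => (hd2 x hx).continuousAt.continuousWithinAt) fun x hx p q hpq => ?_
    by_contra! hq
    have hlow : LowerParabola f x ((h y + δ) * x - p) (h y + δ - q) := by
      filter_upwards [hpq] with w hw
      linear_combination hw
    have := hlo x (hI hx).1 _ _ (by linarith) hlow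
    linarith [(hI hx).2.2]
  have m1 : MonotoneOn (fun x => f' x - (h y - δ) * x) (Ioo l u) :=
    (c1.monotoneOn_deriv fun x hx => (hd1 x hx).differentiableAt).congr
      fun x hx => (hd1 x hx).deriv
  have m2 : MonotoneOn (fun x => (h y + δ) * x - f' x) (Ioo l u) :=
    (c2.monotoneOn_deriv fun x hx => (hd2 x hx).differentiableAt).congr
      fun x hx => (hd2 x hx).deriv
  filter_upwards [Ioo_mem_nhds hyI.1 hyI.2] with x hx
  rw [Real.norm_eq_abs, Real.norm_eq_abs, smul_eq_mul]
  refine le_trans ?_ (mul_le_mul_of_nonneg_right hδδ' (abs_nonneg _))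
  rcases le_total x y with hxy | hxy
  · have e1 := m1 hx hyI hxy
    have e2 := m2 hx hyI hxy
    simp only at e1 e2
    rw [abs_of_nonpos (sub_nonpos.2 hxy), abs_le]
    constructor <;> nlinarith
  · have e1 := m1 hyI hx hxy
    have e2 := m2 hyI hx hxy
    simp only at e1 e2
    rw [abs_of_nonneg (sub_nonneg.2 hxy), abs_le]
    constructor <;> nlinarith

/-- A differentiable function that decreases strictly whenever it takes the value `β` cannot
cross this value upwards. -/
theorem le_of_hasDerivAt_neg_of_eq {f f' : ℝ → ℝ} {a e β : ℝ}
    (hd : ∀ x ∈ Ico a e, HasDerivAt f (f' x) x) (ha : f a ≤ β)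
    (hneg : ∀ x ∈ Ico a e, f x = β → f' x < 0) : ∀ x ∈ Ico a e, f x ≤ β := by
  intro x hx
  have hsub : ∀ y ∈ Icc a x, y ∈ Ico a e := fun y hy => ⟨hy.1, hy.2.trans_lt hx.2⟩
  exact image_le_of_deriv_right_lt_deriv_boundary (B := fun _ => β) (B' := fun _ => 0)
    (fun y hy => (hd y (hsub y hy)).continuousAt.continuousWithinAt)
    (fun y hy => (hd y (hsub y ⟨hy.1, hy.2.le⟩)).hasDerivWithinAt) ha
    (fun y => hasDerivAt_const y β) (fun y hy hyb => hneg y (hsub y ⟨hy.1, hy.2.le⟩) hyb)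
    ⟨hx.1, le_rfl⟩

/-! ### The exponential substitution and the viscosity inequalities -/

/-- The constant-order part of the equation for `v = exp (ε u)`, with slope `p` at `x`. The
equation becomes `defect * v'' = R v'²`. -/
noncomputable def defect (r c lam : ℝ) (v : ℝ → ℝ) (x p : ℝ) : ℝ :=
  (r * x - c) * p - lam * (v x * Real.log (v x))

/-- The properties of `v = exp (ε u)`, for a viscosity solution `u`, that do not mention `ε`. -/
structure IsExpSolution (r c lam R b : ℝ) (v : ℝ → ℝ) : Prop where
  continuousOn : ContinuousOn v (Icc b (c / r))
  one_le : ∀ x ∈ Icc b (c / r), 1 ≤ v x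
  ruin : 1 < v b
  safe : v (c / r) = 1
  upper : ∀ x ∈ Ioo b (c / r), ∀ p q, UpperParabola v x p q →
    0 ≤ q ∧ 0 ≤ defect r c lam v x p ∧ R * p ^ 2 ≤ defect r c lam v x p * q
  lower : ∀ x ∈ Ioo b (c / r), ∀ p q, 0 < q → LowerParabola v x p q →
    defect r c lam v x p * q ≤ R * p ^ 2

theorem hasDerivAt_parabola (y p q x w : ℝ) :
    HasDerivAt (fun w : ℝ => y + p * (w - x) + q / 2 * (w - x) ^ 2) (p + q * (w - x)) w := by
  have h := (hasDerivAt_id w).sub_const x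
  exact (((hasDerivAt_const w y).add (h.const_mul p)).add
    ((h.pow 2).const_mul (q / 2))).congr_deriv (by simp; ring)

theorem deriv_parabola (y p q x : ℝ) :
    deriv (fun w : ℝ => y + p * (w - x) + q / 2 * (w - x) ^ 2) = fun w => p + q * (w - x) :=
  funext fun w => (hasDerivAt_parabola y p q x w).deriv

theorem deriv_deriv_parabola (y p q x w : ℝ) :
    deriv (deriv (fun w : ℝ => y + p * (w - x) + q / 2 * (w - x) ^ 2)) w = q := by
  rw [deriv_parabola]
  exact ((((hasDerivAt_id w).sub_const x).const_mul q).const_add p).deriv.trans (mul_one q)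

section ExpParabola

variable (ε y p q P Q x : ℝ)

theorem hasDerivAt_exp_parabola_sub (w : ℝ) :
    HasDerivAt (fun w : ℝ => Real.exp (ε * (y + p * (w - x) + q / 2 * (w - x) ^ 2)) -
        (Real.exp (ε * y) + P * (w - x) + Q / 2 * (w - x) ^ 2))
      (Real.exp (ε * (y + p * (w - x) + q / 2 * (w - x) ^ 2)) * (ε * (p + q * (w - x))) -
        (P + Q * (w - x))) w :=
  ((hasDerivAt_parabola y p q x w).const_mul ε).exp.sub (hasDerivAt_parabola _ P Q x w)

theorem deriv_deriv_exp_parabola_sub :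
    deriv (deriv (fun w : ℝ => Real.exp (ε * (y + p * (w - x) + q / 2 * (w - x) ^ 2)) -
        (Real.exp (ε * y) + P * (w - x) + Q / 2 * (w - x) ^ 2))) x =
      Real.exp (ε * y) * (ε * (ε * p ^ 2 + q)) - Q := by
  rw [show deriv (fun w : ℝ => Real.exp (ε * (y + p * (w - x) + q / 2 * (w - x) ^ 2)) -
        (Real.exp (ε * y) + P * (w - x) + Q / 2 * (w - x) ^ 2)) = _ from
    funext fun w => (hasDerivAt_exp_parabola_sub ε y p q P Q x w).deriv]
  have h1 := ((hasDerivAt_parabola y p q x x).const_mul ε).exp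
  have h2 : ∀ a b : ℝ, HasDerivAt (fun w : ℝ => a + b * (w - x)) b x := fun a b =>
    ((((hasDerivAt_id x).sub_const x).const_mul b).const_add a).congr_deriv (mul_one b)
  refine ((h1.mul ((h2 p q).const_mul ε)).sub (h2 P Q)).deriv.trans ?_
  simp
  ring

/-- Both sides agree to first order at `x`; the strict gap between the second derivatives decides
the comparison nearby. -/
theorem exp_parabola_isLocalMin (hp : Real.exp (ε * y) * (ε * p) = P)
    (hQ : Q < Real.exp (ε * y) * (ε * (ε * p ^ 2 + q))) :
    ∀ᶠ w in 𝓝 x, Real.exp (ε * y) + P * (w - x) + Q / 2 * (w - x) ^ 2 ≤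
      Real.exp (ε * (y + p * (w - x) + q / 2 * (w - x) ^ 2)) := by
  have hd := hasDerivAt_exp_parabola_sub ε y p q P Q x x
  have hmin := isLocalMin_of_deriv_deriv_pos
    (by rw [deriv_deriv_exp_parabola_sub ε y p q P Q x]; linarith)
    (by rw [hd.deriv]; simp [hp]) hd.continuousAt
  filter_upwards [hmin] with w hw
  simp at hw
  linarith

theorem exp_parabola_isLocalMax (hp : Real.exp (ε * y) * (ε * p) = P)
    (hQ : Real.exp (ε * y) * (ε * (ε * p ^ 2 + q)) < Q) :
    ∀ᶠ w in 𝓝 x, Real.exp (ε * (y + p * (w - x) + q / 2 * (w - x) ^ 2)) ≤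
      Real.exp (ε * y) + P * (w - x) + Q / 2 * (w - x) ^ 2 := by
  have hd := hasDerivAt_exp_parabola_sub ε y p q P Q x x
  have hmax := isLocalMax_of_deriv_deriv_neg
    (by rw [deriv_deriv_exp_parabola_sub ε y p q P Q x]; linarith)
    (by rw [hd.deriv]; simp [hp]) hd.continuousAt
  filter_upwards [hmax] with w hw
  simp at hw
  linarith

end ExpParabola

theorem contDiff_parabola (y p q x : ℝ) :
    ContDiff ℝ 2 (fun w : ℝ => y + p * (w - x) + q / 2 * (w - x) ^ 2) := by fun_prop

theorem hjbOperator_nonpos_iff (r μ σ c lam ε w y p q : ℝ) :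
    hjbOperator r μ σ c lam ε w y p q ≤ 0 ↔
      ∀ a, lam * y ≤ hjbBracket r μ σ c ε w p q a := by
  rw [hjbOperator, EReal.sub_nonpos, le_iInf_iff]
  simp only [EReal.coe_le_coe_iff]

theorem hjbOperator_neg_of_lt {r μ σ c lam ε w y p q β : ℝ} (hβ : lam * y < β)
    (h : ∀ a, β ≤ hjbBracket r μ σ c ε w p q a) :
    hjbOperator r μ σ c lam ε w y p q < 0 := by
  have h1 : ((β : ℝ) : EReal) ≤ ⨅ a : ℝ, ((hjbBracket r μ σ c ε w p q a : ℝ) : EReal) :=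
    le_iInf fun a => EReal.coe_le_coe_iff.2 (h a)
  refine (EReal.sub_le_sub le_rfl h1).trans_lt ?_
  rw [← EReal.coe_sub, ← EReal.coe_zero, EReal.coe_lt_coe_iff]
  linarith

theorem quadratic_bound {A B C y : ℝ} (h : ∀ a : ℝ, y ≤ A * a ^ 2 + B * a + C) :
    0 ≤ A ∧ y ≤ C ∧ B ^ 2 ≤ 4 * A * (C - y) := by
  have h0 := h 0
  have hC : y ≤ C := by simpa using h0
  have hdisc : discrim A B (C - y) ≤ 0 := discrim_le_zero fun a => by
    have := h a; nlinarith
  rw [discrim] at hdisc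
  refine ⟨?_, hC, by linarith⟩
  by_contra! hA
  have hB : B ^ 2 ≤ 0 := by nlinarith
  have hB0 : B = 0 := by nlinarith
  subst hB0
  -- With `B = 0` and `A < 0` this point is at least 1, so `A a² ≤ A a`, which is already below `y -
  -- C`.
  have := h ((C - y + 1) / (-A) + 1)
  have hs : 0 ≤ (C - y) / (-A) := div_nonneg (by linarith) (by linarith)
  set s := (C - y + 1) / (-A) with hs'
  have hAs : A * s = -(C - y + 1) := by
    rw [hs', div_neg, mul_neg, mul_div_cancel₀ _ hA.ne]
  have hs0 : 0 < s := div_pos (by linarith) (by linarith)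
  nlinarith

section Transfer

variable {r μ σ c lam ε b : ℝ} {u : ℝ → ℝ}

/-- The logarithm of a parabola is not a parabola, so a parabola for `u` is matched to value, slope
and a slightly larger curvature `q' > q`. It then touches `u` from above; the subsolution inequality
bounds a quadratic from below, and `q'` decreases to `q`. -/
theorem IsRobustRuinSolution.upper (hu : IsRobustRuinSolution r μ σ c lam ε b u)
    (hσ : 0 < σ) (hε : 0 < ε) {x : ℝ} (hx : x ∈ Ioo b (c / r)) {p q : ℝ}
    (h : UpperParabola (fun w => Real.exp (ε * u w)) x p q) :
    0 ≤ q ∧ 0 ≤ defect r c lam (fun w => Real.exp (ε * u w)) x p ∧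
      constR r μ σ * p ^ 2 ≤ defect r c lam (fun w => Real.exp (ε * u w)) x p * q := by
  set V := Real.exp (ε * u x) with hV
  have hV0 : 0 < V := Real.exp_pos _
  have hdef : defect r c lam (fun w => Real.exp (ε * u w)) x p =
      ε * V * ((r * x - c) * (p / (V * ε)) - lam * u x) := by
    have hlog : Real.log V = ε * u x := Real.log_exp _
    simp only [defect, ← hV, hlog]; field_simp
  have key : ∀ q' > q, 0 ≤ q' ∧ 0 ≤ defect r c lam (fun w => Real.exp (ε * u w)) x p ∧
      constR r μ σ * p ^ 2 ≤ defect r c lam (fun w => Real.exp (ε * u w)) x p * q' := by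
    intro q' hq'
    obtain ⟨P, hP⟩ : ∃ P, P = p / (V * ε) := ⟨_, rfl⟩
    obtain ⟨Q, hQ⟩ : ∃ Q, Q = q' / (V * ε) - ε * P ^ 2 := ⟨_, rfl⟩
    have hPp : V * (ε * P) = p := by rw [hP]; field_simp
    have hQq : V * (ε * (ε * P ^ 2 + Q)) = q' := by rw [hQ]; field_simp; ring
    have hmin := exp_parabola_isLocalMin ε (u x) P Q p q x hPp (hQq ▸ hq')
    have hmax : IsLocalMax (fun w => u w - (u x + P * (w - x) + Q / 2 * (w - x) ^ 2)) x := by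
      filter_upwards [h, hmin] with w h1 h2
      have h3 := Real.exp_le_exp.1 (h1.trans h2)
      have h4 := le_of_mul_le_mul_left h3 hε
      simp only [sub_self, mul_zero, add_zero, ne_eq, OfNat.ofNat_ne_zero, not_false_eq_true,
        zero_pow]
      linarith
    have hF := hu.subsolution _ (contDiff_parabola (u x) P Q x).contDiffOn x hx hmax
    rw [deriv_deriv_parabola, deriv_parabola, hjbOperator_nonpos_iff] at hF
    obtain ⟨hA, hC, hB⟩ := quadratic_bound (A := 1 / 2 * σ ^ 2 * (ε * P ^ 2 + Q))
      (B := (μ - r) * P) (C := (r * x - c) * P) (y := lam * u x) fun a => by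
        have := hF a
        simpa [hjbBracket] using this
    have hA' : 0 ≤ ε * P ^ 2 + Q := by
      by_contra! hneg
      have : 0 < 1 / 2 * σ ^ 2 := by positivity
      nlinarith
    rw [hdef, ← hP]
    refine ⟨by rw [← hQq]; positivity, mul_nonneg (by positivity) (by linarith), ?_⟩
    rw [← hQq, ← hPp, constR, div_pow]
    have hVe : 0 < (V * ε) ^ 2 := by positivity
    have e1 : 1 / 2 * ((μ - r) ^ 2 / σ ^ 2) * (V * (ε * P)) ^ 2 =
      (V * ε) ^ 2 / (2 * σ ^ 2) * ((μ - r) * P) ^ 2 := by field_simp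
    have e2 : ε * V * ((r * x - c) * P - lam * u x) * (V * (ε * (ε * P ^ 2 + Q))) =
      (V * ε) ^ 2 / (2 * σ ^ 2) * (4 * (1 / 2 * σ ^ 2 * (ε * P ^ 2 + Q)) *
        ((r * x - c) * P - lam * u x)) := by field_simp; ring
    rw [e1, e2]
    exact mul_le_mul_of_nonneg_left hB (by positivity)
  refine ⟨le_of_forall_gt_imp_ge_of_dense fun q' hq' => (key q' hq').1,
    (key (q + 1) (by linarith)).2.1, ?_⟩
  have hlim : Tendsto (fun q' => defect r c lam (fun w => Real.exp (ε * u w)) x p * q') (𝓝[>] q)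
      (𝓝 (defect r c lam (fun w => Real.exp (ε * u w)) x p * q)) :=
    ((continuous_const.mul continuous_id).tendsto q).mono_left nhdsWithin_le_nhds
  exact ge_of_tendsto hlim (eventually_mem_nhdsWithin.mono fun q' hq' => (key q' hq').2.2)

/-- As for parabolas from above, now with `q'` increasing to `q`. Positive `q'` makes the quadratic
in the investment strictly convex, so its minimum is explicit. -/
theorem IsRobustRuinSolution.lower (hu : IsRobustRuinSolution r μ σ c lam ε b u)
    (hσ : 0 < σ) (hε : 0 < ε) {x : ℝ} (hx : x ∈ Ioo b (c / r)) {p q : ℝ} (hq : 0 < q)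
    (h : LowerParabola (fun w => Real.exp (ε * u w)) x p q) :
    defect r c lam (fun w => Real.exp (ε * u w)) x p * q ≤ constR r μ σ * p ^ 2 := by
  set V := Real.exp (ε * u x) with hV
  have hV0 : 0 < V := Real.exp_pos _
  have hdef : defect r c lam (fun w => Real.exp (ε * u w)) x p =
      ε * V * ((r * x - c) * (p / (V * ε)) - lam * u x) := by
    have hlog : Real.log V = ε * u x := Real.log_exp _
    simp only [defect, ← hV, hlog]; field_simp
  have key : ∀ q' ∈ Ioo 0 q,
      defect r c lam (fun w => Real.exp (ε * u w)) x p * q' ≤ constR r μ σ * p ^ 2 := by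
    intro q' hq'
    obtain ⟨P, hP⟩ : ∃ P, P = p / (V * ε) := ⟨_, rfl⟩
    obtain ⟨Q, hQ⟩ : ∃ Q, Q = q' / (V * ε) - ε * P ^ 2 := ⟨_, rfl⟩
    have hPp : V * (ε * P) = p := by rw [hP]; field_simp
    have hA : ε * P ^ 2 + Q = q' / (V * ε) := by rw [hQ]; ring
    have hQq : V * (ε * (ε * P ^ 2 + Q)) = q' := by rw [hA]; field_simp
    have hmax := exp_parabola_isLocalMax ε (u x) P Q p q x hPp (hQq ▸ hq'.2)
    have hmin : IsLocalMin (fun w => u w - (u x + P * (w - x) + Q / 2 * (w - x) ^ 2)) x := by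
      filter_upwards [h, hmax] with w h1 h2
      have h3 := Real.exp_le_exp.1 (h2.trans h1)
      have h4 := le_of_mul_le_mul_left h3 hε
      simp only [sub_self, mul_zero, add_zero, ne_eq, OfNat.ofNat_ne_zero, not_false_eq_true,
        zero_pow]
      linarith
    have hF := hu.supersolution _ (contDiff_parabola (u x) P Q x).contDiffOn x hx hmin
    rw [deriv_deriv_parabola, deriv_parabola] at hF
    by_contra! hlt
    have hA0 : 0 < ε * P ^ 2 + Q := by rw [hA]; exact div_pos hq'.1 (by positivity)
    obtain ⟨A, hAdef⟩ : ∃ A, A = ε * P ^ 2 + Q := ⟨_, rfl⟩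
    rw [← hAdef] at hA0 hQq
    -- `β` is the minimum of the bracket, found by completing the square.
    refine absurd hF (not_le.2 (hjbOperator_neg_of_lt
      (β := (r * x - c) * P - ((μ - r) * P) ^ 2 / (2 * σ ^ 2 * A)) ?_ fun a => ?_))
    · rw [hdef, ← hP, ← hQq, ← hPp, constR, div_pow] at hlt
      have e1 : 1 / 2 * ((μ - r) ^ 2 / σ ^ 2) * (V * (ε * P)) ^ 2 =
        (V * ε) ^ 2 * A * (((μ - r) * P) ^ 2 / (2 * σ ^ 2 * A)) := by field_simp
      have e2 : ε * V * ((r * x - c) * P - lam * u x) * (V * (ε * A)) =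
        (V * ε) ^ 2 * A * ((r * x - c) * P - lam * u x) := by ring
      rw [e1, e2] at hlt
      have := lt_of_mul_lt_mul_left hlt (by positivity)
      linarith
    · have : hjbBracket r μ σ c ε x (P + Q * (x - x)) Q a -
          ((r * x - c) * P - ((μ - r) * P) ^ 2 / (2 * σ ^ 2 * A)) =
          (σ ^ 2 * A * a + (μ - r) * P) ^ 2 / (2 * σ ^ 2 * A) := by
        rw [hjbBracket, sub_self, mul_zero, add_zero, ← hAdef]
        field_simp
        ring
      have h2 : 0 ≤ (σ ^ 2 * A * a + (μ - r) * P) ^ 2 / (2 * σ ^ 2 * A) := by positivity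
      linarith
  have hlim : Tendsto (fun q' => defect r c lam (fun w => Real.exp (ε * u w)) x p * q') (𝓝[<] q)
      (𝓝 (defect r c lam (fun w => Real.exp (ε * u w)) x p * q)) :=
    ((continuous_const.mul continuous_id).tendsto q).mono_left nhdsWithin_le_nhds
  exact le_of_tendsto hlim (mem_of_superset (Ioo_mem_nhdsLT hq) key)

/-- At a negative interior minimum a constant test function makes the bracket vanish identically,
leaving `F = lam * u < 0`. -/
theorem IsRobustRuinSolution.nonneg (hu : IsRobustRuinSolution r μ σ c lam ε b u)
    (hlam : 0 < lam) (hb : b < c / r) : ∀ x ∈ Icc b (c / r), 0 ≤ u x := by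
  obtain ⟨y, hy, hmin⟩ :=
    isCompact_Icc.exists_isMinOn (nonempty_Icc.2 hb.le) hu.continuousOn
  have hmin' := isMinOn_iff.1 hmin
  suffices 0 ≤ u y from fun x hx => this.trans (hmin' x hx)
  by_contra! hneg
  have hyb : y ≠ b := by rintro rfl; linarith [hu.ruin]
  have hye : y ≠ c / r := by rintro rfl; linarith [hu.safe]
  have hyI : y ∈ Ioo b (c / r) := ⟨lt_of_le_of_ne hy.1 hyb.symm, lt_of_le_of_ne hy.2 hye⟩
  have hloc : IsLocalMin (fun w => u w - (fun _ => (0 : ℝ)) w) y := by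
    filter_upwards [Icc_mem_nhds hyI.1 hyI.2] with w hw
    simpa using hmin' w hw
  have hF := hu.supersolution _ contDiffOn_const y hyI hloc
  refine absurd hF (not_le.2 (hjbOperator_neg_of_lt (β := 0) (by nlinarith) fun a => ?_))
  simp [hjbBracket]

theorem IsRobustRuinSolution.isExpSolution (hu : IsRobustRuinSolution r μ σ c lam ε b u)
    (hσ : 0 < σ) (hlam : 0 < lam) (hε : 0 < ε) (hb : b < c / r) :
    IsExpSolution r c lam (constR r μ σ) b (fun w => Real.exp (ε * u w)) where
  continuousOn := Real.continuous_exp.comp_continuousOn (continuousOn_const.mul hu.continuousOn)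
  one_le x hx := Real.one_le_exp (mul_nonneg hε.le (hu.nonneg hlam hb x hx))
  ruin := by rw [hu.ruin]; exact Real.one_lt_exp_iff.2 (by linarith)
  safe := by simp [hu.safe]
  upper x hx p q h := hu.upper hσ hε hx h
  lower x hx p q hq h := hu.lower hσ hε hx hq h

end Transfer

/-! ### Regularity and strict signs for the transformed equation -/

theorem UpperParabola.slope_eq {f : ℝ → ℝ} {f' x p q : ℝ} (h : UpperParabola f x p q)
    (hd : HasDerivAt f f' x) : p = f' := by
  have hmax : IsLocalMax (fun w => f w - (f x + p * (w - x) + q / 2 * (w - x) ^ 2)) x := by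
    filter_upwards [h] with w hw
    simpa using hw
  have := hmax.hasDerivAt_eq_zero (hd.sub (hasDerivAt_parabola (f x) p q x x))
  simp at this
  linarith

theorem LowerParabola.slope_eq {f : ℝ → ℝ} {f' x p q : ℝ} (h : LowerParabola f x p q)
    (hd : HasDerivAt f f' x) : p = f' := by
  have hmin : IsLocalMin (fun w => f w - (f x + p * (w - x) + q / 2 * (w - x) ^ 2)) x := by
    filter_upwards [h] with w hw
    simpa using hw
  have := hmin.hasDerivAt_eq_zero (hd.sub (hasDerivAt_parabola (f x) p q x x))
  simp at this
  linarith

/-- The slope of a parabola touching a convex function from above at `y` is at least any right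
derivative further to the left. -/
theorem UpperParabola.rightDeriv_le {f : ℝ → ℝ} {a e x y ρ p q : ℝ}
    (hf : ConvexOn ℝ (Ioo a e) f) (hx : x ∈ Ioo a e) (hy : y ∈ Ioo a e) (hxy : x < y)
    (hρ : HasDerivWithinAt f ρ (Ioi x) x) (h : UpperParabola f y p q) : ρ ≤ p := by
  have hlim : Tendsto (fun w => p + q / 2 * (w - y)) (𝓝[>] y) (𝓝 p) := by
    have : Continuous fun w : ℝ => p + q / 2 * (w - y) := by fun_prop
    simpa using (this.tendsto y).mono_left nhdsWithin_le_nhds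
  refine ge_of_tendsto hlim ?_
  filter_upwards [nhdsWithin_le_nhds h, nhdsWithin_le_nhds (Ioo_mem_nhds hy.1 hy.2),
    self_mem_nhdsWithin] with w hw hwI hyw
  have hyw : y < w := hyw
  have h1 := hf.le_slope_of_hasDerivWithinAt_Ioi hx hy hxy hρ
  have h2 := hf.slope_mono_adjacent hx hwI hxy hyw
  rw [slope_def_field] at h1
  have h3 : (f w - f y) / (w - y) ≤ p + q / 2 * (w - y) := by
    rw [div_le_iff₀ (sub_pos.2 hyw)]
    linear_combination hw
  linarith

namespace IsExpSolution

variable {r c lam R b : ℝ} {v : ℝ → ℝ}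

theorem sub_pos_of_lt (hr : 0 < r) {x : ℝ} (hx : x < c / r) : 0 < c - r * x := by
  rw [lt_div_iff₀ hr] at hx; linarith

theorem convexOn (h : IsExpSolution r c lam R b v) : ConvexOn ℝ (Ioo b (c / r)) v :=
  convexOn_of_upperParabola (h.continuousOn.mono Ioo_subset_Icc_self)
    fun x hx p q hpq => (h.upper x hx p q hpq).1

theorem continuousAt (h : IsExpSolution r c lam R b v) {x : ℝ} (hx : x ∈ Ioo b (c / r)) :
    ContinuousAt v x :=
  h.continuousOn.continuousAt (Icc_mem_nhds hx.1 hx.2)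

theorem pos (h : IsExpSolution r c lam R b v) {x : ℝ} (hx : x ∈ Ioo b (c / r)) : 0 < v x :=
  zero_lt_one.trans_le (h.one_le x (Ioo_subset_Icc_self hx))

/-- Points touched from above accumulate at `x` from the right, with slopes at least `ρ`. There the
defect is nonnegative, and it decreases in the slope because `r y - c < 0`; continuity carries the
sign to `x`. -/
theorem defect_nonneg_of_rightDeriv (h : IsExpSolution r c lam R b v) (hr : 0 < r) {x ρ : ℝ}
    (hx : x ∈ Ioo b (c / r)) (hρ : HasDerivWithinAt v ρ (Ioi x) x) :
    0 ≤ defect r c lam v x ρ := by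
  by_contra! hneg
  have hcont : ContinuousAt (fun y => defect r c lam v y ρ) x := by
    have hv := h.continuousAt hx
    have hl := hv.log (h.pos hx).ne'
    unfold defect
    fun_prop
  obtain ⟨l, w, ⟨hlx, hxw⟩, hsub⟩ := mem_nhds_iff_exists_Ioo_subset.1
    (inter_mem (hcont.eventually (gt_mem_nhds hneg)) (Ioo_mem_nhds hx.1 hx.2))
  have hI : ∀ y ∈ Ioo x w, y ∈ Ioo l w := fun y hy => ⟨hlx.trans hy.1, hy.2⟩
  obtain ⟨t, hxt, htw⟩ := exists_between hxw
  obtain ⟨y, hy, p, q, hpq⟩ := exists_upperParabola hxt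
    (fun y hy => (h.continuousAt (hsub (show y ∈ Ioo l w from
      ⟨hlx.trans_le hy.1, hy.2.trans_lt htw⟩)).2).continuousWithinAt)
  have hyI := hsub (hI y ⟨hy.1, hy.2.trans htw⟩)
  have h1 := hpq.rightDeriv_le h.convexOn hx hyI.2 hy.1 hρ
  have h2 := (h.upper y hyI.2 p q hpq).2.1
  have h3 : defect r c lam v y ρ < 0 := hyI.1
  have h4 := sub_pos_of_lt hr hyI.2.2
  unfold defect at h2 h3
  nlinarith

theorem hasDerivAt (h : IsExpSolution r c lam R b v) (hr : 0 < r) {x : ℝ}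
    (hx : x ∈ Ioo b (c / r)) : HasDerivAt v (deriv v x) x := by
  have hint : x ∈ interior (Ioo b (c / r)) := by rwa [interior_Ioo]
  have hρ := h.convexOn.hasDerivWithinAt_rightDeriv_of_mem_interior hint
  have hl := h.convexOn.hasDerivWithinAt_leftDeriv_of_mem_interior hint
  have hle := h.convexOn.leftDeriv_le_rightDeriv_of_mem_interior hint
  have hD := h.defect_nonneg_of_rightDeriv hr hx hρ
  set ρ := derivWithin v (Ioi x) x
  set l := derivWithin v (Iio x) x
  suffices l = ρ by
    rw [this] at hl
    have hd : HasDerivAt v ρ x := by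
      have := (hl.Iic_of_Iio).union (hρ.Ici_of_Ioi)
      rwa [Iic_union_Ici, hasDerivWithinAt_univ] at this
    exact hd.differentiableAt.hasDerivAt
  by_contra hne
  obtain ⟨p, hlp, hpρ⟩ := exists_between (lt_of_le_of_ne hle hne)
  have hk := sub_pos_of_lt hr hx.2
  have hDp : 0 < defect r c lam v x p := by
    unfold defect at hD ⊢
    nlinarith
  set D := defect r c lam v x p with hDdef
  have hRp : ∀ q, 0 < q → D * q ≤ R * p ^ 2 := by
    intro q hq
    refine h.lower x hx p q hq ?_
    -- Within `δ` of `x` the secants of the parabola from `x` have slopes between `l` and `ρ`, so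
    -- the kink stays above it.
    obtain ⟨δ, hδ, hδ1, hδ2⟩ : ∃ δ, 0 < δ ∧ q / 2 * δ ≤ ρ - p ∧ q / 2 * δ ≤ p - l := by
      refine ⟨min ((ρ - p) / (q / 2)) ((p - l) / (q / 2)), lt_min ?_ ?_, ?_, ?_⟩
      · exact div_pos (sub_pos.2 hpρ) (by linarith)
      · exact div_pos (sub_pos.2 hlp) (by linarith)
      · refine (mul_le_mul_of_nonneg_left (min_le_left _ _) (by linarith)).trans_eq ?_
        field_simp
      · refine (mul_le_mul_of_nonneg_left (min_le_right _ _) (by linarith)).trans_eq ?_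
        field_simp
    filter_upwards [Ioo_mem_nhds hx.1 hx.2,
      Ioo_mem_nhds (sub_lt_self x hδ) (lt_add_of_pos_right x hδ)] with w hwI hwδ
    rcases lt_trichotomy w x with hw | rfl | hw
    · have := h.convexOn.slope_le_of_hasDerivWithinAt_Iio hwI hx hw hl
      rw [slope_def_field, div_le_iff₀ (sub_pos.2 hw)] at this
      have h2 : q / 2 * (x - w) ≤ p - l := by nlinarith [hwδ.1]
      nlinarith [mul_le_mul_of_nonneg_right h2 (sub_pos.2 hw).le]
    · simp
    · have := h.convexOn.le_slope_of_hasDerivWithinAt_Ioi hx hwI hw hρ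
      rw [slope_def_field, le_div_iff₀ (sub_pos.2 hw)] at this
      have h2 : q / 2 * (w - x) ≤ ρ - p := by nlinarith [hwδ.2]
      nlinarith [mul_le_mul_of_nonneg_right h2 (sub_pos.2 hw).le]
  -- No sign of `R` is assumed: curvature 1 gives `0 < D ≤ R p²`, so the next curvature is positive.
  have h1 := hRp 1 one_pos
  have h2 := hRp ((R * p ^ 2 + 1) / D) (div_pos (by linarith) hDp)
  rw [mul_div_cancel₀ _ hDp.ne'] at h2
  linarith

theorem defect_nonneg (h : IsExpSolution r c lam R b v) (hr : 0 < r) {x : ℝ}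
    (hx : x ∈ Ioo b (c / r)) : 0 ≤ defect r c lam v x (deriv v x) :=
  h.defect_nonneg_of_rightDeriv hr hx (h.hasDerivAt hr hx).hasDerivWithinAt

theorem continuousOn_deriv (h : IsExpSolution r c lam R b v) (hr : 0 < r) :
    ContinuousOn (deriv v) (Ioo b (c / r)) :=
  h.convexOn.continuousOn_of_hasDerivAt fun _ hx => h.hasDerivAt hr hx

theorem continuousOn_defect (h : IsExpSolution r c lam R b v) (hr : 0 < r) :
    ContinuousOn (fun x => defect r c lam v x (deriv v x)) (Ioo b (c / r)) := by
  have hv := h.continuousOn.mono Ioo_subset_Icc_self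
  have hl := hv.log fun x hx => (h.pos hx).ne'
  have hd := h.continuousOn_deriv hr
  unfold defect
  fun_prop

theorem mul_log_nonneg (h : IsExpSolution r c lam R b v) {x : ℝ} (hx : x ∈ Ioo b (c / r)) :
    0 ≤ v x * Real.log (v x) :=
  mul_nonneg (h.pos hx).le (Real.log_nonneg (h.one_le x (Ioo_subset_Icc_self hx)))

theorem deriv_nonpos (h : IsExpSolution r c lam R b v) (hr : 0 < r) (hlam : 0 < lam) {x : ℝ}
    (hx : x ∈ Ioo b (c / r)) : deriv v x ≤ 0 := by
  have h1 := h.defect_nonneg hr hx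
  have h2 := mul_nonneg hlam.le (h.mul_log_nonneg hx)
  have h3 := sub_pos_of_lt hr hx.2
  unfold defect at h1
  by_contra! hpos
  nlinarith [mul_pos h3 hpos]

theorem antitoneOn (h : IsExpSolution r c lam R b v) (hr : 0 < r) (hlam : 0 < lam) :
    AntitoneOn v (Icc b (c / r)) := by
  refine antitoneOn_of_deriv_nonpos (convex_Icc _ _) h.continuousOn ?_ ?_
  · rw [interior_Icc]
    exact fun x hx => (h.hasDerivAt hr hx).differentiableAt.differentiableWithinAt
  · rw [interior_Icc]
    exact fun x hx => h.deriv_nonpos hr hlam hx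

theorem deriv_neg_of_one_lt (h : IsExpSolution r c lam R b v) (hr : 0 < r) (hlam : 0 < lam) {x : ℝ}
    (hx : x ∈ Ioo b (c / r)) (hv : 1 < v x) : deriv v x < 0 := by
  refine lt_of_le_of_ne (h.deriv_nonpos hr hlam hx) fun h0 => ?_
  have h1 := h.defect_nonneg hr hx
  rw [h0, defect] at h1
  have := mul_pos hlam (mul_pos (h.pos hx) (Real.log_pos hv))
  linarith

/-- The equation holds classically where the defect is positive. -/
theorem hasDerivAt_deriv_of_defect_pos (h : IsExpSolution r c lam R b v) (hr : 0 < r) (hR : 0 < R)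
    {a e x : ℝ} (hsub : Ioo a e ⊆ Ioo b (c / r)) (hx : x ∈ Ioo a e)
    (hD : ∀ y ∈ Ioo a e, 0 < defect r c lam v y (deriv v y)) (hv : deriv v x < 0) :
    HasDerivAt (deriv v) (R * deriv v x ^ 2 / defect r c lam v x (deriv v x)) x := by
  have hnhds := isOpen_Ioo.mem_nhds (hsub hx)
  have hd := (h.continuousOn_deriv hr).continuousAt hnhds
  have hDc := (h.continuousOn_defect hr).continuousAt hnhds
  refine hasDerivAt_of_parabolas
    (h := fun x => R * deriv v x ^ 2 / defect r c lam v x (deriv v x)) hx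
    (fun y hy => h.hasDerivAt hr (hsub hy))
    ((continuousAt_const.mul (hd.pow 2)).div hDc (hD x hx).ne') ?_ ?_ ?_
  · have := hD x hx
    have : 0 < deriv v x ^ 2 := by nlinarith
    positivity
  · intro y hy p q hpq
    have := (h.upper y (hsub hy) p q hpq).2.2
    rw [hpq.slope_eq (h.hasDerivAt hr (hsub hy))] at this
    rwa [div_le_iff₀' (hD y hy)]
  · intro y hy p q hq hpq
    have := h.lower y (hsub hy) p q hq hpq
    rw [hpq.slope_eq (h.hasDerivAt hr (hsub hy))] at this
    rwa [le_div_iff₀' (hD y hy)]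

theorem hasDerivAt_defect (h : IsExpSolution r c lam R b v) (hr : 0 < r) {x q : ℝ}
    (hx : x ∈ Ioo b (c / r)) (hq : HasDerivAt (deriv v) q x) :
    HasDerivAt (fun x => defect r c lam v x (deriv v x))
      (r * deriv v x + (r * x - c) * q - lam * (1 + Real.log (v x)) * deriv v x) x := by
  have hv := h.hasDerivAt hr hx
  have hl := hv.mul (hv.log (h.pos hx).ne')
  have hk := ((hasDerivAt_id x).const_mul r).sub_const c
  refine ((hk.mul hq).sub (hl.const_mul lam)).congr_deriv ?_
  have := (h.pos hx).ne'
  simp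
  field_simp
  ring

/-- Just to the right of a last zero of `D`, the term `(r w - c) R v'² / D` dominates `D'` and makes
it negative, so `D` cannot leave zero. Thus a zero persists to the right, and any point touched from
above there gives `R v'² ≤ 0`, contrary to `v' < 0`. -/
theorem defect_pos_of_one_lt (h : IsExpSolution r c lam R b v) (hr : 0 < r) (hlam : 0 < lam) (hR : 0 < R)
    {e : ℝ} (he : e ≤ c / r) (hv : ∀ x ∈ Ioo b e, 1 < v x) {x : ℝ} (hx : x ∈ Ioo b e) :
    0 < defect r c lam v x (deriv v x) := by
  have hsub : Ioo b e ⊆ Ioo b (c / r) := Ioo_subset_Ioo_right he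
  have hneg : ∀ y ∈ Ioo b e, deriv v y < 0 := fun y hy =>
    h.deriv_neg_of_one_lt hr hlam (hsub hy) (hv y hy)
  have hDc := h.continuousOn_defect hr
  refine lt_of_le_of_ne (h.defect_nonneg hr (hsub hx)) fun hx0 => ?_
  have hzero : ∀ y ∈ Ioo x e, defect r c lam v y (deriv v y) = 0 := by
    intro y hy
    by_contra hy0
    have hxy : Icc x y ⊆ Ioo b e := fun w hw => ⟨hx.1.trans_le hw.1, hw.2.trans_lt hy.2⟩
    obtain ⟨a, ⟨haI, ha0⟩, hamax⟩ := IsCompact.exists_isGreatest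
      (s := Icc x y ∩ (fun x => defect r c lam v x (deriv v x)) ⁻¹' {0})
      (isCompact_Icc.of_isClosed_subset
        ((hDc.mono (hxy.trans hsub)).preimage_isClosed_of_isClosed isClosed_Icc
          isClosed_singleton) inter_subset_left) ⟨x, ⟨le_rfl, hy.1.le⟩, hx0.symm⟩
    have ha0 : defect r c lam v a (deriv v a) = 0 := ha0
    have hay : a < y := lt_of_le_of_ne haI.2 (by rintro rfl; exact hy0 ha0)
    have hpos : ∀ w ∈ Ioo a y, 0 < defect r c lam v w (deriv v w) := by
      intro w hw
      have hwI : w ∈ Icc x y := ⟨haI.1.trans hw.1.le, hw.2.le⟩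
      refine lt_of_le_of_ne (h.defect_nonneg hr (hsub (hxy hwI))) fun hw0 => ?_
      exact absurd (hamax ⟨hwI, hw0.symm⟩) (not_le.2 hw.1)
    have haI' := hsub (hxy haI)
    have hnhds := isOpen_Ioo.mem_nhds haI'
    have hd := (h.continuousOn_deriv hr).continuousAt hnhds
    have hDa := hDc.continuousAt hnhds
    -- This is `D * D'` with `v''` eliminated; unlike `D'`, it is continuous at the zero `a` of `D`.
    have hcont : ContinuousAt (fun w => defect r c lam v w (deriv v w) *
        (r * deriv v w - lam * (1 + Real.log (v w)) * deriv v w) +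
        (r * w - c) * (R * deriv v w ^ 2)) a := by
      have hva := h.continuousAt haI'
      have hl := hva.log (h.pos haI').ne'
      fun_prop
    have hlt : ∀ᶠ w in 𝓝 a, defect r c lam v w (deriv v w) *
        (r * deriv v w - lam * (1 + Real.log (v w)) * deriv v w) +
        (r * w - c) * (R * deriv v w ^ 2) < 0 := by
      refine hcont.eventually (gt_mem_nhds ?_)
      beta_reduce
      rw [ha0, zero_mul, zero_add]
      have h1 := sub_pos_of_lt hr haI'.2
      have h2 := hneg a (hxy haI)
      have : 0 < R * deriv v a ^ 2 := mul_pos hR (by nlinarith)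
      nlinarith
    obtain ⟨l, w, ⟨hla, haw⟩, hlw⟩ := mem_nhds_iff_exists_Ioo_subset.1 hlt
    obtain ⟨t, hat, htw⟩ := exists_between (lt_min haw hay)
    have htw1 := htw.trans_le (min_le_left _ _)
    have hty := htw.trans_le (min_le_right _ _)
    have hder : ∀ s ∈ Ioo a t, HasDerivAt (fun x => defect r c lam v x (deriv v x))
        (r * deriv v s + (r * s - c) * (R * deriv v s ^ 2 / defect r c lam v s (deriv v s)) -
          lam * (1 + Real.log (v s)) * deriv v s) s := by
      intro s hs
      have hsI : s ∈ Ioo a y := ⟨hs.1, hs.2.trans hty⟩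
      have hsI' : s ∈ Ioo b e := hxy ⟨haI.1.trans hs.1.le, hsI.2.le⟩
      exact h.hasDerivAt_defect hr (hsub hsI') (h.hasDerivAt_deriv_of_defect_pos hr hR
        (fun z hz => hsub (hxy ⟨haI.1.trans hz.1.le, hz.2.le⟩)) hsI hpos (hneg s hsI'))
    have hanti : AntitoneOn (fun x => defect r c lam v x (deriv v x)) (Icc a t) := by
      refine antitoneOn_of_deriv_nonpos (convex_Icc _ _)
        (hDc.mono fun z hz => hsub (hxy ⟨haI.1.trans hz.1, hz.2.trans hty.le⟩)) ?_ ?_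
      · rw [interior_Icc]
        exact fun s hs => (hder s hs).differentiableAt.differentiableWithinAt
      · rw [interior_Icc]
        intro s hs
        rw [(hder s hs).deriv]
        have h1 := hpos s ⟨hs.1, hs.2.trans hty⟩
        have h2 : _ < (0 : ℝ) := hlw ⟨hla.trans hs.1, hs.2.trans htw1⟩
        set D := defect r c lam v s (deriv v s)
        have h3 : D * (r * deriv v s + (r * s - c) * (R * deriv v s ^ 2 / D) -
            lam * (1 + Real.log (v s)) * deriv v s) < 0 := by
          convert h2 using 1
          field_simp
          ring
        by_contra! hge
        exact absurd h3 (not_lt.2 (mul_nonneg h1.le hge.le))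
    have h1 := hanti ⟨le_rfl, hat.le⟩ ⟨hat.le, le_rfl⟩ hat.le
    have h2 := hpos t ⟨hat, hty⟩
    simp only [ha0] at h1
    linarith
  obtain ⟨t, hxt, hte⟩ := exists_between hx.2
  have hxtI : Icc x t ⊆ Ioo b e := fun w hw => ⟨hx.1.trans_le hw.1, hw.2.trans_lt hte⟩
  obtain ⟨y, hy, p, q, hpq⟩ := exists_upperParabola hxt
    (fun y hy => (h.continuousAt (hsub (hxtI hy))).continuousWithinAt)
  have hyI := hxtI (Ioo_subset_Icc_self hy)
  have h1 := (h.upper y (hsub hyI) p q hpq).2.2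
  rw [hpq.slope_eq (h.hasDerivAt hr (hsub hyI)), hzero y ⟨hy.1, hy.2.trans hte⟩, zero_mul] at h1
  have h2 := hneg y hyI
  have : 0 < R * deriv v y ^ 2 := mul_pos hR (by nlinarith)
  linarith

/-- At a first interior point `e` with `v = 1` the slope vanishes. Just before `e`, convexity bounds
the logarithmic term by a small multiple of `-v'`, hence `v'' ≤ -K v'`, and by Grönwall's argument a
negative slope cannot reach zero at `e`. -/
theorem one_lt (h : IsExpSolution r c lam R b v) (hr : 0 < r) (hlam : 0 < lam) (hR : 0 < R)
    {x : ℝ} (hx : x ∈ Ioo b (c / r)) : 1 < v x := by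
  by_contra! hx1
  obtain ⟨e, ⟨heI, he1⟩, hemin⟩ := IsCompact.exists_isLeast
    (s := Icc b (c / r) ∩ v ⁻¹' Iic 1)
    (isCompact_Icc.of_isClosed_subset
      (h.continuousOn.preimage_isClosed_of_isClosed isClosed_Icc isClosed_Iic)
      inter_subset_left) ⟨x, Ioo_subset_Icc_self hx, hx1⟩
  have hex : e ≤ x := hemin ⟨Ioo_subset_Icc_self hx, hx1⟩
  have hve : v e = 1 := le_antisymm he1 (h.one_le e heI)
  have hbe : b < e := lt_of_le_of_ne heI.1 (by rintro rfl; linarith [h.ruin])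
  have he : e ∈ Ioo b (c / r) := ⟨hbe, hex.trans_lt hx.2⟩
  have hsub : Ioo b e ⊆ Ioo b (c / r) := Ioo_subset_Ioo_right he.2.le
  have hv : ∀ y ∈ Ioo b e, 1 < v y := by
    intro y hy
    by_contra! hy1
    exact absurd (hemin ⟨Ioo_subset_Icc_self (hsub hy), hy1⟩) (not_le.2 hy.2)
  have hde : deriv v e = 0 := by
    refine IsLocalMin.deriv_eq_zero ?_
    filter_upwards [Icc_mem_nhds he.1 he.2] with y hy
    rw [hve]; exact h.one_le y hy
  have hk := sub_pos_of_lt hr he.2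
  have hev : ∀ᶠ y in 𝓝 e, lam * v y * (e - y) < (c - r * e) / 2 := by
    have hc : ContinuousAt (fun y => lam * v y * (e - y)) e := by
      have := h.continuousAt he
      fun_prop
    refine hc.eventually (gt_mem_nhds ?_)
    simp only [sub_self, mul_zero]
    linarith
  obtain ⟨l, w, ⟨hle, hew⟩, hlw⟩ := mem_nhds_iff_exists_Ioo_subset.1 hev
  obtain ⟨a, ha1, hae⟩ := exists_between (max_lt hle hbe)
  have hla := (le_max_left _ _).trans_lt ha1
  have hba := (le_max_right _ _).trans_lt ha1
  set K := 2 * R / (c - r * e) with hKdef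
  have hder : ∀ y ∈ Ioo b e, HasDerivAt (fun y => deriv v y * Real.exp (K * y))
      (R * deriv v y ^ 2 / defect r c lam v y (deriv v y) * Real.exp (K * y) +
        deriv v y * (Real.exp (K * y) * K)) y := by
    intro y hy
    refine (h.hasDerivAt_deriv_of_defect_pos hr hR hsub hy
      (fun z hz => h.defect_pos_of_one_lt hr hlam hR he.2.le hv hz)
      (h.deriv_neg_of_one_lt hr hlam (hsub hy) (hv y hy))).mul ?_
    exact (((hasDerivAt_id y).const_mul K).congr_deriv (mul_one K)).exp
  have hanti : AntitoneOn (fun y => deriv v y * Real.exp (K * y)) (Icc a e) := by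
    refine antitoneOn_of_deriv_nonpos (convex_Icc _ _) ?_ ?_ ?_
    · refine ContinuousOn.mul ((h.continuousOn_deriv hr).mono fun z hz =>
        ⟨hba.trans_le hz.1, hz.2.trans_lt he.2⟩) ?_
      fun_prop
    · rw [interior_Icc]
      exact fun s hs =>
        (hder s ⟨hba.trans hs.1, hs.2⟩).differentiableAt.differentiableWithinAt
    · rw [interior_Icc]
      intro s hs
      have hsI : s ∈ Ioo b e := ⟨hba.trans hs.1, hs.2⟩
      rw [(hder s hsI).deriv]
      have hD := h.defect_pos_of_one_lt hr hlam hR he.2.le hv hsI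
      have hneg := h.deriv_neg_of_one_lt hr hlam (hsub hsI) (hv s hsI)
      have h1 : lam * v s * (e - s) < (c - r * e) / 2 :=
        hlw ⟨hla.trans hs.1, hs.2.trans hew⟩
      have h2 : v s - 1 ≤ -deriv v s * (e - s) := by
        have := h.convexOn.le_slope_of_hasDerivAt (hsub hsI) he hs.2 (h.hasDerivAt hr (hsub hsI))
        rw [slope_def_field, le_div_iff₀ (sub_pos.2 hs.2), hve] at this
        linarith
      have h3 := Real.log_le_sub_one_of_pos (h.pos (hsub hsI))
      have h4 : lam * (v s * Real.log (v s)) ≤ (c - r * e) / 2 * -deriv v s := by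
        have hp : 0 < lam * v s := mul_pos hlam (h.pos (hsub hsI))
        calc lam * (v s * Real.log (v s)) = lam * v s * Real.log (v s) := by ring
          _ ≤ lam * v s * (-deriv v s * (e - s)) :=
            mul_le_mul_of_nonneg_left (h3.trans h2) hp.le
          _ = lam * v s * (e - s) * -deriv v s := by ring
          _ ≤ _ := mul_le_mul_of_nonneg_right h1.le (by linarith)
      have h5 : (c - r * e) / 2 * -deriv v s ≤ defect r c lam v s (deriv v s) := by
        unfold defect
        nlinarith [mul_pos (mul_pos hr (sub_pos.2 hs.2)) (neg_pos.2 hneg)]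
      have h6 : R * deriv v s ^ 2 / defect r c lam v s (deriv v s) ≤ -deriv v s * K := by
        rw [div_le_iff₀ hD]
        calc R * deriv v s ^ 2 = -deriv v s * K * ((c - r * e) / 2 * -deriv v s) := by
              rw [hKdef]; field_simp
          _ ≤ _ := mul_le_mul_of_nonneg_left h5
              (mul_nonneg (by linarith) (by positivity))
      have h7 := Real.exp_pos (K * s)
      nlinarith
  have h1 := hanti ⟨le_rfl, hae.le⟩ ⟨hae.le, le_rfl⟩ hae.le
  simp only [hde, zero_mul] at h1
  have h2 := mul_pos_of_neg_of_neg
    (h.deriv_neg_of_one_lt hr hlam (hsub ⟨hba, hae⟩) (hv a ⟨hba, hae⟩))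
    (neg_neg_of_pos (Real.exp_pos (K * a)))
  linarith

end IsExpSolution

/-! ### The first-order equation for the ratio and its asymptotics -/

namespace IsExpSolution

variable {r c lam R b : ℝ} {v : ℝ → ℝ}

/-- The ratio of the defect to `-v'`, that is `R * (-v') / v''` by the equation: a multiple of the
feedback strategy. -/
noncomputable def ratio (r c lam : ℝ) (v : ℝ → ℝ) (x : ℝ) : ℝ :=
  defect r c lam v x (deriv v x) / -deriv v x

theorem log_le (h : IsExpSolution r c lam R b v) (hr : 0 < r) (hlam : 0 < lam) {x : ℝ}
    (hx : x ∈ Ioo b (c / r)) : Real.log (v x) ≤ Real.log (v b) :=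
  Real.log_le_log (h.pos hx) (h.antitoneOn hr hlam ⟨le_rfl, (hx.1.trans hx.2).le⟩
    (Ioo_subset_Icc_self hx) hx.1.le)

theorem tendsto_log (h : IsExpSolution r c lam R b v) (hb : b < c / r) :
    Tendsto (fun x => Real.log (v x)) (𝓝[<] (c / r)) (𝓝 0) := by
  have h1 : ContinuousWithinAt v (Icc b (c / r)) (c / r) := h.continuousOn _ ⟨hb.le, le_rfl⟩
  have h2 : Tendsto v (𝓝[<] (c / r)) (𝓝 1) := by
    rw [← h.safe, ← nhdsWithin_Ioo_eq_nhdsLT hb]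
    exact h1.mono Ioo_subset_Icc_self
  simpa using h2.log one_ne_zero

section

variable (h : IsExpSolution r c lam R b v) (hr : 0 < r) (hlam : 0 < lam) (hR : 0 < R)
include h hr hlam hR

theorem deriv_neg {x : ℝ} (hx : x ∈ Ioo b (c / r)) : deriv v x < 0 :=
  h.deriv_neg_of_one_lt hr hlam hx (h.one_lt hr hlam hR hx)

theorem defect_pos {x : ℝ} (hx : x ∈ Ioo b (c / r)) :
    0 < defect r c lam v x (deriv v x) :=
  h.defect_pos_of_one_lt hr hlam hR le_rfl (fun _ hy => h.one_lt hr hlam hR hy) hx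

theorem hasDerivAt_deriv {x : ℝ} (hx : x ∈ Ioo b (c / r)) :
    HasDerivAt (deriv v) (R * deriv v x ^ 2 / defect r c lam v x (deriv v x)) x :=
  h.hasDerivAt_deriv_of_defect_pos hr hR Subset.rfl hx (fun _ hy => h.defect_pos hr hlam hR hy)
    (h.deriv_neg hr hlam hR hx)

theorem ratio_pos {x : ℝ} (hx : x ∈ Ioo b (c / r)) : 0 < ratio r c lam v x :=
  div_pos (h.defect_pos hr hlam hR hx) (neg_pos.2 (h.deriv_neg hr hlam hR hx))

/-- Inserting `v'' = R v'² / D` cancels `v'`; `v` survives only through `log v`, which vanishes at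
the safe level. -/
theorem hasDerivAt_ratio {x : ℝ} (hx : x ∈ Ioo b (c / r)) :
    HasDerivAt (ratio r c lam v)
      (lam * (1 + Real.log (v x)) - r + R - R * ((c - r * x) / ratio r c lam v x)) x := by
  have hneg := h.deriv_neg hr hlam hR hx
  have hD := h.defect_pos hr hlam hR hx
  have hq := h.hasDerivAt_deriv hr hlam hR hx
  refine ((h.hasDerivAt_defect hr hx hq).div hq.neg (neg_pos.2 hneg).ne').congr_deriv ?_
  unfold ratio
  simp only [Pi.neg_apply]
  set D := defect r c lam v x (deriv v x)
  have h1 := hneg.ne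
  field_simp
  ring

theorem log_pos {x : ℝ} (hx : x ∈ Ioo b (c / r)) : 0 < Real.log (v x) :=
  Real.log_pos (h.one_lt hr hlam hR hx)

theorem hasDerivAt_ratio_sub {N : ℝ} (hNR : lam + R - r + r * N = R / N) {x : ℝ}
    (hx : x ∈ Ioo b (c / r)) :
    HasDerivAt (fun x => ratio r c lam v x - N * (c - r * x))
      (lam * Real.log (v x) + R / N - R * ((c - r * x) / ratio r c lam v x)) x := by
  have h1 := (((hasDerivAt_id x).const_mul r).const_sub c).const_mul N
  refine ((h.hasDerivAt_ratio hr hlam hR hx).sub h1).congr_deriv ?_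
  rw [← hNR]
  ring

/-- If the bound fails at `x`, the difference `m - N (c - r y)` starts at or below a negative level
which it can only cross downwards. It then stays there up to the safe level, where `m > 0` and `N (c
- r y) → 0` are incompatible with it. -/
theorem lt_ratio {N : ℝ} (hNR : lam + R - r + r * N = R / N) {n x : ℝ} (hn : 0 < n)
    (hnN : n < N) (hx : x ∈ Ioo b (c / r)) (hlog : lam * Real.log (v x) < R / n - R / N) :
    n * (c - r * x) < ratio r c lam v x := by
  by_contra! hle
  have hkx := sub_pos_of_lt hr hx.2
  have hneg : (n - N) * (c - r * x) < 0 := by nlinarith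
  have hfence := le_of_hasDerivAt_neg_of_eq (β := (n - N) * (c - r * x))
    (f := fun y => ratio r c lam v y - N * (c - r * y))
    (fun y (hy : y ∈ Ico x (c / r)) =>
      (h.hasDerivAt_ratio_sub hr hlam hR hNR ⟨hx.1.trans_le hy.1, hy.2⟩))
    (by linarith) ?_
  · have hk : Tendsto (fun y => -(N * (c - r * y))) (𝓝 (c / r)) (𝓝 _) :=
      Continuous.tendsto (by fun_prop) _
    have hlim : ∀ᶠ y in 𝓝[<] (c / r), (n - N) * (c - r * x) < -(N * (c - r * y)) :=
      (hk.mono_left nhdsWithin_le_nhds).eventually (lt_mem_nhds (by rw [mul_div_cancel₀ _ hr.ne']; linarith))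
    obtain ⟨y, hy1, hy2⟩ := (hlim.and (Ioo_mem_nhdsLT hx.2)).exists
    have h1 := hfence y ⟨hy2.1.le, hy2.2⟩
    have h2 := h.ratio_pos hr hlam hR ⟨hx.1.trans hy2.1, hy2.2⟩
    linarith
  · intro y hy hyeq
    have hyI : y ∈ Ioo b (c / r) := ⟨hx.1.trans_le hy.1, hy.2⟩
    have hm := h.ratio_pos hr hlam hR hyI
    have h1 : Real.log (v y) ≤ Real.log (v x) :=
      Real.log_le_log (h.pos hyI) (h.antitoneOn hr hlam (Ioo_subset_Icc_self hx)
        (Ioo_subset_Icc_self hyI) hy.1)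
    have h2 : 1 / n ≤ (c - r * y) / ratio r c lam v y := by
      rw [div_le_div_iff₀ hn hm]
      have : r * x ≤ r * y := mul_le_mul_of_nonneg_left hy.1 hr.le
      nlinarith
    have h3 := mul_le_mul_of_nonneg_left h2 hR.le
    rw [mul_one_div] at h3
    have h4 := mul_le_mul_of_nonneg_left h1 hlam.le
    linarith

variable {N : ℝ} (hN : 0 < N) (hNR : lam + R - r + r * N = R / N)
include hN hNR

/-- A positive excess over `N (c - r x)` cannot decrease, since `log v > 0`, whereas the crude bound
`m ≤ c - r y` forces the excess to vanish at the safe level. -/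
theorem ratio_le {x : ℝ} (hx : x ∈ Ioo b (c / r)) : ratio r c lam v x ≤ N * (c - r * x) := by
  have hle : ∀ y ∈ Ioo b (c / r), ratio r c lam v y ≤ c - r * y := by
    intro y hy
    have h1 := h.deriv_neg hr hlam hR hy
    have h2 := mul_nonneg hlam.le (h.mul_log_nonneg hy)
    rw [ratio, div_le_iff₀ (neg_pos.2 h1), defect]
    linarith
  by_contra! hlt
  have hfence := le_of_hasDerivAt_neg_of_eq
    (f := fun y => -(ratio r c lam v y - N * (c - r * y)))
    (fun y (hy : y ∈ Ico x (c / r)) =>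
      (h.hasDerivAt_ratio_sub hr hlam hR hNR ⟨hx.1.trans_le hy.1, hy.2⟩).neg) le_rfl ?_
  · have hk : Tendsto (fun y => c - r * y) (𝓝 (c / r)) (𝓝 _) :=
      Continuous.tendsto (by fun_prop) _
    have hlim : ∀ᶠ y in 𝓝[<] (c / r), c - r * y < ratio r c lam v x - N * (c - r * x) :=
      (hk.mono_left nhdsWithin_le_nhds).eventually (gt_mem_nhds (by rw [mul_div_cancel₀ _ hr.ne']; linarith))
    obtain ⟨y, hy1, hy2⟩ := (hlim.and (Ioo_mem_nhdsLT hx.2)).exists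
    have h1 := hfence y ⟨hy2.1.le, hy2.2⟩
    have h2 := hle y ⟨hx.1.trans hy2.1, hy2.2⟩
    have h3 := mul_pos hN (sub_pos_of_lt hr hy2.2)
    linarith
  · intro y hy hyeq
    have hyI : y ∈ Ioo b (c / r) := ⟨hx.1.trans_le hy.1, hy.2⟩
    have hm := h.ratio_pos hr hlam hR hyI
    have h1 := mul_pos hlam (h.log_pos hr hlam hR hyI)
    have h2 : (c - r * y) / ratio r c lam v y ≤ 1 / N := by
      rw [div_le_div_iff₀ hm hN]
      linarith
    have h3 := mul_le_mul_of_nonneg_left h2 hR.le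
    rw [mul_one_div] at h3
    linarith

theorem exists_bound_deriv_ratio :
    ∃ C, ∀ x ∈ Ioo b (c / r), |deriv (ratio r c lam v) x| ≤ C := by
  have hL : 0 ≤ lam * Real.log (v b) := mul_nonneg hlam.le (Real.log_nonneg h.ruin.le)
  -- With `n = R / S` the gap `R / n - R / N` exceeds `lam * log v` throughout the interval, so the
  -- lower barrier holds globally and bounds the singular term by `S`.
  obtain ⟨S, hS⟩ : ∃ S, S = R / N + lam * Real.log (v b) + 1 := ⟨_, rfl⟩
  have hRN : 0 < R / N := div_pos hR hN
  have hS0 : 0 < S := by linarith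
  have hn : 0 < R / S := div_pos hR hS0
  have hnN : R / S < N := by
    rw [div_lt_iff₀ hS0, ← div_lt_iff₀' hN]; linarith
  refine ⟨lam + lam * Real.log (v b) + r + R + S, fun x hx => ?_⟩
  rw [(h.hasDerivAt_ratio hr hlam hR hx).deriv]
  have hRS : R / (R / S) = S := by field_simp
  have hlog := mul_le_mul_of_nonneg_left (h.log_le hr hlam hx) hlam.le
  have hlog0 := mul_pos hlam (h.log_pos hr hlam hR hx)
  have hm := h.ratio_pos hr hlam hR hx
  have hlow := h.lt_ratio hr hlam hR hNR hn hnN hx (by rw [hRS]; linarith)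
  have hk := sub_pos_of_lt hr hx.2
  have h1 : R * ((c - r * x) / ratio r c lam v x) ≤ S := by
    rw [← mul_div_assoc, div_le_iff₀ hm]
    have := mul_le_mul_of_nonneg_left hlow.le hS0.le
    calc R * (c - r * x) = S * (R / S * (c - r * x)) := by field_simp
      _ ≤ _ := this
  have h2 : 0 < R * ((c - r * x) / ratio r c lam v x) := by positivity
  rw [abs_le]
  constructor <;> linarith

theorem tendsto_ratio_div (hb : b < c / r) :
    Tendsto (fun x => ratio r c lam v x / (c - r * x)) (𝓝[<] (c / r)) (𝓝 N) := by
  refine tendsto_order.2 ⟨fun l hl => ?_, fun l hl => ?_⟩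
  · obtain ⟨n, hn1, hnN⟩ := exists_between (max_lt hl hN)
    have hn : 0 < n := (le_max_right _ _).trans_lt hn1
    have hpos : 0 < R / n - R / N := sub_pos.2 (div_lt_div_of_pos_left hR hn hnN)
    have hlim := (h.tendsto_log hb).const_mul lam
    rw [mul_zero] at hlim
    filter_upwards [hlim.eventually (gt_mem_nhds hpos), Ioo_mem_nhdsLT hb] with x hx hxI
    have := h.lt_ratio hr hlam hR hNR hn hnN hxI hx
    exact ((le_max_left _ _).trans_lt hn1).trans
      ((lt_div_iff₀ (sub_pos_of_lt hr hxI.2)).2 this)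
  · filter_upwards [Ioo_mem_nhdsLT hb] with x hx
    refine lt_of_le_of_lt ?_ hl
    rw [div_le_iff₀ (sub_pos_of_lt hr hx.2)]
    exact h.ratio_le hr hlam hR hN hNR hx

theorem tendsto_ratio (hb : b < c / r) :
    Tendsto (ratio r c lam v) (𝓝[<] (c / r)) (𝓝 0) := by
  have hk : Tendsto (fun x => c - r * x) (𝓝[<] (c / r)) (𝓝 0) := by
    have hc : Continuous fun x : ℝ => c - r * x := by fun_prop
    have := (hc.tendsto (c / r)).mono_left (nhdsWithin_le_nhds (s := Iio (c / r)))
    rwa [mul_div_cancel₀ _ hr.ne', sub_self] at this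
  have hlim := (h.tendsto_ratio_div hr hlam hR hN hNR hb).mul hk
  rw [mul_zero] at hlim
  refine hlim.congr' ?_
  filter_upwards [self_mem_nhdsWithin] with x hx
  exact div_mul_cancel₀ _ (sub_pos_of_lt hr hx).ne'

theorem tendsto_deriv_ratio (hb : b < c / r) :
    Tendsto (deriv (ratio r c lam v)) (𝓝[<] (c / r)) (𝓝 (-(r * N))) := by
  have h1 := (h.tendsto_ratio_div hr hlam hR hN hNR hb).inv₀ hN.ne'
  have h2 := h.tendsto_log hb
  have h3 := ((((h2.const_add 1).const_mul lam).sub_const r).add_const R).sub (h1.const_mul R)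
  have h4 : lam * (1 + 0) - r + R - R * N⁻¹ = -(r * N) := by
    rw [← div_eq_mul_inv, ← hNR]; ring
  rw [h4] at h3
  refine h3.congr' ?_
  filter_upwards [Ioo_mem_nhdsLT hb] with x hx
  rw [(h.hasDerivAt_ratio hr hlam hR hx).deriv, inv_div]

end

end IsExpSolution

/-! ### The constants of the non-robust problem -/

section Constants

variable {r μ σ lam : ℝ}

theorem constR_pos (hμ : r < μ) (hσ : 0 < σ) : 0 < constR r μ σ := by
  have := div_pos (sub_pos.2 hμ) hσ
  unfold constR; positivity

theorem discriminant_pos (hr : 0 < r) (hμ : r < μ) (hσ : 0 < σ) (hlam : 0 < lam) :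
    (r - lam) ^ 2 < (r + lam + constR r μ σ) ^ 2 - 4 * r * lam := by
  have hR := constR_pos hμ hσ
  nlinarith [mul_pos hr hR, mul_pos hlam hR]

theorem one_lt_constD (hr : 0 < r) (hμ : r < μ) (hσ : 0 < σ) (hlam : 0 < lam) :
    1 < constD r μ σ lam := by
  have hR := constR_pos hμ hσ
  have h1 := Real.lt_sqrt_of_sq_lt (discriminant_pos hr hμ hσ hlam)
  unfold constD
  rw [one_div, ← div_eq_inv_mul, one_lt_div (by positivity)]
  linarith

theorem constD_quadratic (hr : 0 < r) (hμ : r < μ) (hσ : 0 < σ) (hlam : 0 < lam) :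
    r * constD r μ σ lam ^ 2 - (r + lam + constR r μ σ) * constD r μ σ lam + lam = 0 := by
  have h1 := Real.sq_sqrt
    ((sq_nonneg (r - lam)).trans (discriminant_pos (σ := σ) hr hμ hσ hlam).le)
  unfold constD
  generalize Real.sqrt ((r + lam + constR r μ σ) ^ 2 - 4 * r * lam) = s at h1 ⊢
  field_simp
  linear_combination h1

end Constants

/-! ### Return to `u` and its feedback strategy -/

section Strategy

variable {r μ σ c lam ε b : ℝ} {u : ℝ → ℝ}

namespace IsRobustRuinSolution

theorem hasDerivAt (hu : IsRobustRuinSolution r μ σ c lam ε b u) (hr : 0 < r) (hσ : 0 < σ)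
    (hlam : 0 < lam) (hε : 0 < ε) (hb : b < c / r) {x : ℝ} (hx : x ∈ Ioo b (c / r)) :
    HasDerivAt u (deriv (fun w => Real.exp (ε * u w)) x / (ε * Real.exp (ε * u x))) x := by
  have h := hu.isExpSolution hσ hlam hε hb
  have hlog := ((h.hasDerivAt hr hx).log (h.pos hx).ne').div_const ε
  have : (fun w => Real.log (Real.exp (ε * u w)) / ε) = u := by
    funext w; rw [Real.log_exp]; field_simp
  rw [this] at hlog
  exact hlog.congr_deriv (by rw [div_div, mul_comm (Real.exp _)])

variable (hu : IsRobustRuinSolution r μ σ c lam ε b u) (hr : 0 < r) (hμ : r < μ) (hσ : 0 < σ)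
  (hlam : 0 < lam) (hε : 0 < ε) (hb : b < c / r)
include hu hr hμ hσ hlam hε hb

theorem hasDerivAt_deriv {x : ℝ} (hx : x ∈ Ioo b (c / r)) :
    HasDerivAt (deriv u) (deriv (deriv (fun w => Real.exp (ε * u w))) x /
      (ε * Real.exp (ε * u x)) - ε * deriv u x ^ 2) x := by
  have h := hu.isExpSolution hσ hlam hε hb
  have hR := constR_pos hμ hσ
  have hd := (h.hasDerivAt_deriv hr hlam hR hx).differentiableAt.hasDerivAt
  have hv := (h.hasDerivAt hr hx).const_mul ε
  have hpos := Real.exp_pos (ε * u x)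
  have heq : (fun w => deriv (fun w => Real.exp (ε * u w)) w / (ε * Real.exp (ε * u w)))
      =ᶠ[𝓝 x] deriv u := by
    filter_upwards [Ioo_mem_nhds hx.1 hx.2] with w hw
    exact (hu.hasDerivAt hr hσ hlam hε hb hw).deriv.symm
  refine ((hd.div hv (by positivity)).congr_of_eventuallyEq heq.symm).congr_deriv ?_
  rw [(hu.hasDerivAt hr hσ hlam hε hb hx).deriv]
  field_simp

theorem second_order_eq {x : ℝ} (hx : x ∈ Ioo b (c / r)) :
    ε * deriv u x ^ 2 + deriv (deriv u) x =
      deriv (deriv (fun w => Real.exp (ε * u w))) x / (ε * Real.exp (ε * u x)) := by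
  rw [(hu.hasDerivAt_deriv hr hμ hσ hlam hε hb hx).deriv]
  ring

theorem second_order_pos {x : ℝ} (hx : x ∈ Ioo b (c / r)) :
    0 < ε * deriv u x ^ 2 + deriv (deriv u) x := by
  have h := hu.isExpSolution hσ hlam hε hb
  have hR := constR_pos hμ hσ
  rw [hu.second_order_eq hr hμ hσ hlam hε hb hx, (h.hasDerivAt_deriv hr hlam hR hx).deriv]
  have h1 := h.deriv_neg hr hlam hR hx
  have h2 := h.defect_pos hr hlam hR hx
  have h3 := sq_pos_of_neg h1
  positivity

theorem contDiffOn : ContDiffOn ℝ 2 u (Ioo b (c / r)) := by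
  have h := hu.isExpSolution hσ hlam hε hb
  have hR := constR_pos hμ hσ
  have hd := h.continuousOn_deriv hr
  have hv : ContDiffOn ℝ 2 (fun w => Real.exp (ε * u w)) (Ioo b (c / r)) := by
    rw [show (2 : WithTop ℕ∞) = 1 + 1 by norm_num,
      contDiffOn_succ_iff_deriv_of_isOpen isOpen_Ioo]
    refine ⟨fun x hx => (h.hasDerivAt hr hx).differentiableAt.differentiableWithinAt,
      by simp, ?_⟩
    rw [show (1 : WithTop ℕ∞) = 0 + 1 by norm_num,
      contDiffOn_succ_iff_deriv_of_isOpen isOpen_Ioo]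
    refine ⟨fun x hx =>
      (h.hasDerivAt_deriv hr hlam hR hx).differentiableAt.differentiableWithinAt, by simp, ?_⟩
    rw [contDiffOn_zero]
    refine ContinuousOn.congr ?_ fun x hx => (h.hasDerivAt_deriv hr hlam hR hx).deriv
    exact ContinuousOn.div (by fun_prop) (h.continuousOn_defect hr)
      fun x hx => (h.defect_pos hr hlam hR hx).ne'
  refine ((hv.log fun x hx => (h.pos hx).ne').div_const ε).congr fun x _ => ?_
  rw [Real.log_exp]; field_simp

/-- The factor `ε v` cancels in `u' / (ε u'² + u'') = v' / v''`, and the equation rewrites this as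
`-m / R`. -/
theorem robustStrategy_eq {x : ℝ} (hx : x ∈ Ioo b (c / r)) :
    robustStrategy r μ σ ε u x = (μ - r) / (σ ^ 2 * constR r μ σ) *
      IsExpSolution.ratio r c lam (fun w => Real.exp (ε * u w)) x := by
  have h := hu.isExpSolution hσ hlam hε hb
  have hR := constR_pos hμ hσ
  have h1 := (h.deriv_neg hr hlam hR hx).ne
  have h2 := (h.defect_pos hr hlam hR hx).ne'
  rw [robustStrategy, hu.second_order_eq hr hμ hσ hlam hε hb hx,
    (hu.hasDerivAt hr hσ hlam hε hb hx).deriv, (h.hasDerivAt_deriv hr hlam hR hx).deriv,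
    IsExpSolution.ratio]
  field_simp

theorem hjbBracket_robustStrategy_le {x : ℝ} (hx : x ∈ Ioo b (c / r)) (a : ℝ) :
    hjbBracket r μ σ c ε x (deriv u x) (deriv (deriv u) x) (robustStrategy r μ σ ε u x) ≤
      hjbBracket r μ σ c ε x (deriv u x) (deriv (deriv u) x) a := by
  have hA := hu.second_order_pos hr hμ hσ hlam hε hb hx
  rw [robustStrategy, hjbBracket, hjbBracket]
  generalize ε * deriv u x ^ 2 + deriv (deriv u) x = A at hA ⊢
  have h1 : 0 ≤ 1 / 2 * σ ^ 2 * A * (a + (μ - r) / σ ^ 2 * (deriv u x / A)) ^ 2 := by positivity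
  refine sub_nonneg.1 (h1.trans_eq ?_)
  field_simp
  ring

end IsRobustRuinSolution

end Strategy

/-- The robust optimal investment strategy is well defined, differentiable and Lipschitz on
`(b, c / r)`, and is tangent to the non-robust strategy at the safe level `c / r`. -/
theorem proposition6p4 (r μ σ c lam ε b : ℝ) (hr : 0 < r) (hμ : r < μ) (hσ : 0 < σ)
    (hc : 0 < c) (hlam : 0 < lam) (hε : 0 < ε) (hb : b < c / r)
    (u : ℝ → ℝ) (hu : IsRobustRuinSolution r μ σ c lam ε b u) :
    -- the strategy is given by a formula without degenerate quotients or derivatives,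
    -- and attains the infimum in the equation
    (ContDiffOn ℝ 2 u (Ioo b (c / r)) ∧
      (∀ w ∈ Ioo b (c / r), 0 < ε * deriv u w ^ 2 + deriv (deriv u) w) ∧
      (∀ w ∈ Ioo b (c / r), ∀ a : ℝ,
        hjbBracket r μ σ c ε w (deriv u w) (deriv (deriv u) w) (robustStrategy r μ σ ε u w) ≤
          hjbBracket r μ σ c ε w (deriv u w) (deriv (deriv u) w) a)) ∧
    -- Lipschitz continuity
    (∃ K : NNReal, LipschitzOnWith K (robustStrategy r μ σ ε u) (Ioo b (c / r))) ∧
    -- the limit of the derivative, which is the slope of the non-robust strategy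
    (DifferentiableOn ℝ (robustStrategy r μ σ ε u) (Ioo b (c / r)) ∧
      Tendsto (deriv (robustStrategy r μ σ ε u)) (𝓝[<] (c / r))
        (𝓝 (-((μ - r) / (σ ^ 2 * (constD r μ σ lam - 1))))) ∧
      1 < constD r μ σ lam ∧
      HasDerivAt (nonRobustStrategy r μ σ c lam)
        (-((μ - r) / (σ ^ 2 * (constD r μ σ lam - 1)))) (c / r)) ∧
    -- both strategies take the same (limiting) value at the safe level
    (Tendsto (robustStrategy r μ σ ε u) (𝓝[<] (c / r))
        (𝓝 (nonRobustStrategy r μ σ c lam (c / r))) ∧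
      nonRobustStrategy r μ σ c lam (c / r) = 0) := by
  have h := hu.isExpSolution hσ hlam hε hb
  have hR := constR_pos hμ hσ
  have hd := one_lt_constD hr hμ hσ hlam
  have hd1 := sub_pos.2 hd
  have hquad := constD_quadratic hr hμ hσ hlam
  -- This choice solves the balance equation for `N` by the quadratic equation for `d`, and it
  -- matches `-κ r N` to the slope of the non-robust strategy.
  obtain ⟨N, hNdef⟩ : ∃ N, N = constR r μ σ / (r * (constD r μ σ lam - 1)) := ⟨_, rfl⟩
  have hN : 0 < N := by rw [hNdef]; positivity
  have hNR : lam + constR r μ σ - r + r * N = constR r μ σ / N := by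
    rw [hNdef]
    field_simp
    linear_combination -hquad
  have hslope : (μ - r) / (σ ^ 2 * constR r μ σ) * -(r * N) =
      -((μ - r) / (σ ^ 2 * (constD r μ σ lam - 1))) := by
    rw [hNdef]
    field_simp
  set κ := (μ - r) / (σ ^ 2 * constR r μ σ)
  set m := IsExpSolution.ratio r c lam (fun w => Real.exp (ε * u w))
  have heq : ∀ w ∈ Ioo b (c / r), robustStrategy r μ σ ε u w = κ * m w := fun w hw =>
    hu.robustStrategy_eq hr hμ hσ hlam hε hb hw
  have hder : ∀ w ∈ Ioo b (c / r), HasDerivAt (robustStrategy r μ σ ε u) (κ * deriv m w) w := by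
    intro w hw
    refine ((h.hasDerivAt_ratio hr hlam hR hw).differentiableAt.hasDerivAt.const_mul
      κ).congr_of_eventuallyEq ?_
    filter_upwards [Ioo_mem_nhds hw.1 hw.2] with y hy using heq y hy
  have hzero : nonRobustStrategy r μ σ c lam (c / r) = 0 := by
    rw [nonRobustStrategy, mul_div_cancel₀ _ hr.ne', sub_self, zero_div, mul_zero]
  refine ⟨⟨hu.contDiffOn hr hμ hσ hlam hε hb,
    fun w hw => hu.second_order_pos hr hμ hσ hlam hε hb hw,
    fun w hw a => hu.hjbBracket_robustStrategy_le hr hμ hσ hlam hε hb hw a⟩, ?_,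
    ⟨fun w hw => (hder w hw).differentiableAt.differentiableWithinAt, ?_, hd, ?_⟩, ?_, hzero⟩
  · obtain ⟨C, hC⟩ := h.exists_bound_deriv_ratio hr hlam hR hN hNR
    refine ⟨(|κ| * C).toNNReal, (convex_Ioo _ _).lipschitzOnWith_of_nnnorm_deriv_le
      (fun w hw => (hder w hw).differentiableAt) fun w hw => ?_⟩
    rw [← NNReal.coe_le_coe, coe_nnnorm, (hder w hw).deriv, norm_mul]
    exact (mul_le_mul_of_nonneg_left (hC w hw) (abs_nonneg κ)).trans (Real.le_coe_toNNReal _)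
  · rw [← hslope]
    refine ((h.tendsto_deriv_ratio hr hlam hR hN hNR hb).const_mul κ).congr' ?_
    filter_upwards [Ioo_mem_nhdsLT hb] with w hw using (hder w hw).deriv.symm
  · have hlin := ((((hasDerivAt_id (c / r)).const_mul r).const_sub c).div_const
      ((constD r μ σ lam - 1) * r)).const_mul ((μ - r) / σ ^ 2)
    refine hlin.congr_deriv ?_
    field_simp
  · rw [hzero]
    have hlim := (h.tendsto_ratio hr hlam hR hN hNR hb).const_mul κ
    rw [mul_zero] at hlim
    refine hlim.congr' ?_
    filter_upwards [Ioo_mem_nhdsLT hb] with w hw using (heq w hw).symm
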